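/- Let $R$ be a nonzero commutative ring with identity and let $G$ and $C$ be finite groups. For finite groups $H,K$ put $RB_C(H\times K)=R\otimes_{\mathbb Z}B(H\times K\times C)$, where $B(L)$ is the Grothendieck group, under disjoint union, of the isomorphism classes of finite left $L$-sets. For finite groups $H,L,K$ let $$\circ\colon RB_C(H\times L)\times RB_C(L\times K)\to RB_C(H\times K)$$ be the $R$-bilinear map which sends the classes of a finite $(H\times L\times C)$-set $X$ and a finite $(L\times K\times C)$-set $Y$ to the class of $X\times_L^d Y$, the set of orbits of $L$ on $X\times Y$ for the action $(x,y)\cdot l=((1,l^{-1},1)x,\,(l^{-1},1,1)y)$, with $H\times K\times C$ acting by $(h,k,c)[x,y]=[(h,1,c)x,\,(1,k,c)y]$. Let $I_{RB_C}(G)$ be the $R$-submodule of $RB_C(G\times G)$ generated by all $a\circ b$ with $a\in RB_C(G\times K)$, $b\in RB_C(K\times G)$ and $K$ a finite group with $|K|<|G|$, and let $$\widehat{RB_C}(G)=RB_C(G\times G)/I_{RB_C}(G)$$ be the quotient $R$-module. Then $\widehat{RB_C}(G)\neq 0$. More precisely, for every automorphism $\theta$ of $G$ and every group homomorphism $\zeta\colon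 C\to Z(G)$, let $D_{\theta,\zeta}$ be the subgroup $\{(\theta(g)\zeta(c),g,c)\mid g\in G,\ c\in C\}$ of $G\times G\times C$. Then the class of the transitive $(G\times G\times C)$-set $X_{\theta,\zeta}=(G\times G\times C)/D_{\theta,\zeta}$ is nonzero in $\widehat{RB_C}(G)$; in particular, for every finite group $K$ with $|K|<|G|$ there are no $a\in RB_C(G\times K)$ and $b\in RB_C(K\times G)$ such that the class of $X_{\theta,\zeta}$ equals $a\circ b$. -/

import Mathlib

open scoped TensorProduct

universe u

noncomputable section

/-- A finite (left) `G`-set. -/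
structure FinGSet (G : Type u) [Group G] : Type (u + 1) where
  carrier : Type u
  [finite : Finite carrier]
  [action : MulAction G carrier]

attribute [instance] FinGSet.finite FinGSet.action

namespace FinGSet

variable {G H K C : Type u} [Group G] [Group H] [Group K] [Group C]

/-- Isomorphism of `G`-sets. -/
def Iso (X Y : FinGSet G) : Prop :=
  ∃ e : X.carrier ≃ Y.carrier, ∀ (g : G) (x : X.carrier), e (g • x) = g • e x

instance isoSetoid (G : Type u) [Group G] : Setoid (FinGSet G) where
  r := Iso
  iseqv :=
    { refl := fun X => ⟨Equiv.refl _, fun _ _ => rfl⟩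
      symm := fun {X Y} h => by
        obtain ⟨e, he⟩ := h
        refine ⟨e.symm, fun g y => ?_⟩
        rw [Equiv.symm_apply_eq, he, Equiv.apply_symm_apply]
      trans := fun {X Y Z} h h' => by
        obtain ⟨e, he⟩ := h
        obtain ⟨e', he'⟩ := h'
        exact ⟨e.trans e', fun g x => by simp [he, he']⟩ }

/-- The empty `G`-set. -/
def empty (G : Type u) [Group G] : FinGSet G where
  carrier := PEmpty
  action :=
    { smul := fun _ x => x
      one_smul := fun _ => rfl
      mul_smul := fun _ _ _ => rfl }

/-- The disjoint union of two `G`-sets. -/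
def disjUnion (X Y : FinGSet G) : FinGSet G := ⟨X.carrier ⊕ Y.carrier⟩

/-- The transitive `G`-set `G/D`. -/
def coset [Finite G] (D : Subgroup G) : FinGSet G := ⟨G ⧸ D⟩

/-- The orbit relation of `H` on `X × Y`, where `X` is a `(G × H × C)`-set and `Y` is an
`(H × K × C)`-set. Regarding `X` as a `(G, H)`-biset via `x · h = (1, h⁻¹, 1) • x`, this is the
relation `(x, y) ∼ (x · h, h⁻¹ · y)`. -/
def compSetoid (X : FinGSet (G × H × C)) (Y : FinGSet (H × K × C)) :
    Setoid (X.carrier × Y.carrier) where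
  r p q := ∃ h : H, q = (((1, h⁻¹, 1) : G × H × C) • p.1, ((h⁻¹, 1, 1) : H × K × C) • p.2)
  iseqv :=
    { refl := fun p => ⟨1, by
        rw [inv_one]; exact Prod.ext (one_smul _ p.1).symm (one_smul _ p.2).symm⟩
      symm := fun {p q} hpq => by
        obtain ⟨h, rfl⟩ := hpq
        refine ⟨h⁻¹, ?_⟩
        simp only [smul_smul, Prod.mk_mul_mk, inv_inv, mul_inv_cancel, mul_one]
        exact Prod.ext (one_smul _ p.1).symm (one_smul _ p.2).symm
      trans := fun {p q r} hpq hqr => by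
        obtain ⟨h, rfl⟩ := hpq
        obtain ⟨h', rfl⟩ := hqr
        refine ⟨h * h', ?_⟩
        simp only [smul_smul, Prod.mk_mul_mk, mul_inv_rev, mul_one] }

/-- The composition `X ×_H^d Y` of a `(G × H × C)`-set `X` and an `(H × K × C)`-set `Y`: the set of
`H`-orbits on `X × Y`, with `G` acting on `X`, `K` acting on `Y` and `C` acting diagonally. -/
def comp (X : FinGSet (G × H × C)) (Y : FinGSet (H × K × C)) : FinGSet (G × K × C) where
  carrier := Quotient (compSetoid X Y)
  action :=
    { smul := fun a => Quotient.map
        (fun p => (((a.1, 1, a.2.2) : G × H × C) • p.1, ((1, a.2.1, a.2.2) : H × K × C) • p.2))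
        (by
          rintro p q ⟨h, rfl⟩
          refine ⟨h, ?_⟩
          simp only [smul_smul, Prod.mk_mul_mk, mul_one, one_mul])
      one_smul := by
        rintro ⟨p⟩
        exact congrArg (Quotient.mk _) (Prod.ext (one_smul _ p.1) (one_smul _ p.2))
      mul_smul := by
        rintro a b ⟨p⟩
        refine congrArg (Quotient.mk _) ?_
        simp only [smul_smul, Prod.mk_mul_mk, mul_one]
        rfl }

theorem comp_smul_mk (X : FinGSet (G × H × C)) (Y : FinGSet (H × K × C)) (a : G × K × C)
    (p : X.carrier × Y.carrier) :
    a • (show (comp X Y).carrier from Quotient.mk (compSetoid X Y) p) =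
      Quotient.mk (compSetoid X Y)
        (((a.1, 1, a.2.2) : G × H × C) • p.1, ((1, a.2.1, a.2.2) : H × K × C) • p.2) := rfl

theorem disjUnion_congr {X X' Y Y' : FinGSet G} (hX : X ≈ X') (hY : Y ≈ Y') :
    disjUnion X Y ≈ disjUnion X' Y' := by
  obtain ⟨e, he⟩ := hX
  obtain ⟨f, hf⟩ := hY
  refine ⟨Equiv.sumCongr e f, ?_⟩
  rintro g (x | y)
  · exact congrArg Sum.inl (he g x)
  · exact congrArg Sum.inr (hf g y)

theorem comp_congr {X X' : FinGSet (G × H × C)} {Y Y' : FinGSet (H × K × C)}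
    (hX : X ≈ X') (hY : Y ≈ Y') : comp X Y ≈ comp X' Y' := by
  obtain ⟨e, he⟩ := hX
  obtain ⟨f, hf⟩ := hY
  refine ⟨Quotient.congr (Equiv.prodCongr e f) ?_, ?_⟩
  · rintro ⟨x, y⟩ ⟨x', y'⟩
    refine exists_congr fun h => ?_
    simp [← he, ← hf]
  · rintro a ⟨x, y⟩
    refine congrArg (Quotient.mk (compSetoid X' Y')) (Prod.ext (he _ _) (hf _ _))

theorem comp_disjUnion_left (X X' : FinGSet (G × H × C)) (Y : FinGSet (H × K × C)) :
    comp (disjUnion X X') Y ≈ disjUnion (comp X Y) (comp X' Y) := by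
  refine ⟨⟨Quotient.lift (fun p : (X.carrier ⊕ X'.carrier) × Y.carrier =>
      Sum.map (fun x => Quotient.mk (compSetoid X Y) (x, p.2))
        (fun x => Quotient.mk (compSetoid X' Y) (x, p.2)) p.1) ?_,
      Sum.elim (Quotient.map (fun p => (Sum.inl p.1, p.2)) ?_)
        (Quotient.map (fun p => (Sum.inr p.1, p.2)) ?_), ?_, ?_⟩, ?_⟩
  · rintro ⟨x | x, y⟩ _ ⟨h, rfl⟩
    · exact congrArg Sum.inl (Quotient.sound ⟨h, rfl⟩)
    · exact congrArg Sum.inr (Quotient.sound ⟨h, rfl⟩)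
  · rintro p _ ⟨h, rfl⟩
    exact ⟨h, rfl⟩
  · rintro p _ ⟨h, rfl⟩
    exact ⟨h, rfl⟩
  · rintro ⟨x | x, y⟩ <;> rfl
  · rintro (⟨x, y⟩ | ⟨x, y⟩) <;> rfl
  · rintro a ⟨x | x, y⟩ <;> rfl

theorem comp_disjUnion_right (X : FinGSet (G × H × C)) (Y Y' : FinGSet (H × K × C)) :
    comp X (disjUnion Y Y') ≈ disjUnion (comp X Y) (comp X Y') := by
  refine ⟨⟨Quotient.lift (fun p : X.carrier × (Y.carrier ⊕ Y'.carrier) =>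
      Sum.map (fun y => Quotient.mk (compSetoid X Y) (p.1, y))
        (fun y => Quotient.mk (compSetoid X Y') (p.1, y)) p.2) ?_,
      Sum.elim (Quotient.map (fun p => (p.1, Sum.inl p.2)) ?_)
        (Quotient.map (fun p => (p.1, Sum.inr p.2)) ?_), ?_, ?_⟩, ?_⟩
  · rintro ⟨x, y | y⟩ _ ⟨h, rfl⟩
    · exact congrArg Sum.inl (Quotient.sound ⟨h, rfl⟩)
    · exact congrArg Sum.inr (Quotient.sound ⟨h, rfl⟩)
  · rintro p _ ⟨h, rfl⟩
    exact ⟨h, rfl⟩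
  · rintro p _ ⟨h, rfl⟩
    exact ⟨h, rfl⟩
  · rintro ⟨x, y | y⟩ <;> rfl
  · rintro (⟨x, y⟩ | ⟨x, y⟩) <;> rfl
  · rintro a ⟨x, y | y⟩ <;> rfl

theorem comp_empty_left (Y : FinGSet (H × K × C)) :
    comp (empty (G × H × C)) Y ≈ empty (G × K × C) := by
  have : IsEmpty (comp (empty (G × H × C)) Y).carrier := ⟨by rintro ⟨x, _⟩; exact x.elim⟩
  have : IsEmpty (empty (G × K × C)).carrier := inferInstanceAs (IsEmpty PEmpty)
  exact ⟨Equiv.equivOfIsEmpty _ _, fun _ x => isEmptyElim x⟩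

theorem comp_empty_right (X : FinGSet (G × H × C)) :
    comp X (empty (H × K × C)) ≈ empty (G × K × C) := by
  have : IsEmpty (comp X (empty (H × K × C))).carrier := ⟨by rintro ⟨_, y⟩; exact y.elim⟩
  have : IsEmpty (empty (G × K × C)).carrier := inferInstanceAs (IsEmpty PEmpty)
  exact ⟨Equiv.equivOfIsEmpty _ _, fun _ x => isEmptyElim x⟩

end FinGSet

/-- Isomorphism classes of finite `G`-sets. -/
def GSetClass (G : Type u) [Group G] : Type (u + 1) := Quotient (FinGSet.isoSetoid G)

namespace GSetClass

variable {G H K C : Type u} [Group G] [Group H] [Group K] [Group C]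

def mk (X : FinGSet G) : GSetClass G := Quotient.mk _ X

instance : Zero (GSetClass G) := ⟨mk (FinGSet.empty G)⟩

/-- Addition of isomorphism classes is disjoint union. -/
instance : Add (GSetClass G) :=
  ⟨Quotient.map₂ FinGSet.disjUnion fun _ _ h _ _ h' => FinGSet.disjUnion_congr h h'⟩

instance : AddCommMonoid (GSetClass G) where
  zero_add := by
    rintro ⟨X⟩
    refine Quotient.sound ⟨Equiv.emptySum PEmpty X.carrier, ?_⟩
    rintro g (x | x)
    · exact x.elim
    · rfl
  add_zero := by
    rintro ⟨X⟩
    refine Quotient.sound ⟨Equiv.sumEmpty X.carrier PEmpty, ?_⟩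
    rintro g (x | x)
    · rfl
    · exact x.elim
  add_assoc := by
    rintro ⟨X⟩ ⟨Y⟩ ⟨Z⟩
    refine Quotient.sound ⟨Equiv.sumAssoc _ _ _, ?_⟩
    rintro g ((x | x) | x) <;> rfl
  add_comm := by
    rintro ⟨X⟩ ⟨Y⟩
    refine Quotient.sound ⟨Equiv.sumComm _ _, ?_⟩
    rintro g (x | x) <;> rfl
  nsmul := nsmulRec

/-- The biadditive map on isomorphism classes induced by `FinGSet.comp`. -/
def comp (G H K C : Type u) [Group G] [Group H] [Group K] [Group C] :
    GSetClass (G × H × C) →+ GSetClass (H × K × C) →+ GSetClass (G × K × C) where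
  toFun x :=
    { toFun := fun y => Quotient.map₂ FinGSet.comp
        (fun _ _ h _ _ h' => FinGSet.comp_congr h h') x y
      map_zero' := by
        obtain ⟨X⟩ := x
        exact Quotient.sound (FinGSet.comp_empty_right X)
      map_add' := by
        obtain ⟨X⟩ := x
        rintro ⟨Y⟩ ⟨Y'⟩
        exact Quotient.sound (FinGSet.comp_disjUnion_right X Y Y') }
  map_zero' := by
    ext y
    obtain ⟨Y⟩ := y
    exact Quotient.sound (FinGSet.comp_empty_left Y)
  map_add' := by
    rintro ⟨X⟩ ⟨X'⟩
    ext y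
    obtain ⟨Y⟩ := y
    exact Quotient.sound (FinGSet.comp_disjUnion_left X X' Y)

end GSetClass

/-- The Burnside group `B(G)`: the Grothendieck group of finite `G`-sets under disjoint union. -/
abbrev BurnsideGroup (G : Type u) [Group G] : Type (u + 1) :=
  Algebra.GrothendieckAddGroup (GSetClass G)

namespace BurnsideGroup

/-- The class of a finite `G`-set in `B(G)`. -/
def mk {G : Type u} [Group G] (X : FinGSet G) : BurnsideGroup G :=
  Algebra.GrothendieckAddGroup.of (GSetClass.mk X)

theorem lift_of {M A : Type*} [AddCommMonoid M] [AddCommGroup A] (f : M →+ A) (x : M) :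
    Algebra.GrothendieckAddGroup.lift f (Algebra.GrothendieckAddGroup.of x) = f x :=
  DFunLike.congr_fun (Algebra.GrothendieckAddGroup.lift.left_inv f) x

theorem lift_ext {M A : Type*} [AddCommMonoid M] [AddCommGroup A]
    {f g : Algebra.GrothendieckAddGroup M →+ A}
    (h : ∀ x, f (Algebra.GrothendieckAddGroup.of x) = g (Algebra.GrothendieckAddGroup.of x)) :
    f = g :=
  Algebra.GrothendieckAddGroup.lift.symm.injective (AddMonoidHom.ext h)

/-- Extension of additive maps to the Grothendieck group, as an additive map. -/
def liftHom (M A : Type*) [AddCommMonoid M] [AddCommGroup A] :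
    (M →+ A) →+ (Algebra.GrothendieckAddGroup M →ₗ[ℤ] A) where
  toFun f := (Algebra.GrothendieckAddGroup.lift f).toIntLinearMap
  map_zero' := LinearMap.toAddMonoidHom_injective <| lift_ext fun x => lift_of 0 x
  map_add' f g := LinearMap.toAddMonoidHom_injective <| lift_ext fun x =>
    (lift_of (f + g) x).trans (congrArg₂ (· + ·) (lift_of f x) (lift_of g x)).symm

theorem liftHom_of {M A : Type*} [AddCommMonoid M] [AddCommGroup A] (f : M →+ A) (x : M) :
    liftHom M A f (Algebra.GrothendieckAddGroup.of x) = f x :=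
  lift_of f x

/-- The biadditive map `B(G × H × C) × B(H × K × C) → B(G × K × C)` extending `X ×_H^d Y`. -/
def comp (G H K C : Type u) [Group G] [Group H] [Group K] [Group C] :
    BurnsideGroup (G × H × C) →ₗ[ℤ] BurnsideGroup (H × K × C) →ₗ[ℤ] BurnsideGroup (G × K × C) :=
  liftHom _ _ ((liftHom _ _).comp
    ((AddMonoidHom.compHom Algebra.GrothendieckAddGroup.of).comp (GSetClass.comp G H K C)))

theorem comp_mk {G H K C : Type u} [Group G] [Group H] [Group K] [Group C]
    (X : FinGSet (G × H × C)) (Y : FinGSet (H × K × C)) :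
    comp G H K C (mk X) (mk Y) = mk (FinGSet.comp X Y) := by
  rw [comp, mk, liftHom_of]
  exact liftHom_of _ _

end BurnsideGroup

/-- `RB_C(G × H) = RB(G × H × C) = R ⊗_ℤ B(G × H × C)`. -/
abbrev RBC (R : Type*) [CommRing R] (C G H : Type u) [Group C] [Group G] [Group H] :=
  R ⊗[ℤ] BurnsideGroup (G × H × C)

namespace RBC

variable (R : Type*) [CommRing R] (C : Type u) [Group C]

/-- The class in `RB_C(G × H)` of a finite `(G × H × C)`-set. -/
def mk {C G H : Type u} [Group C] [Group G] [Group H] (X : FinGSet (G × H × C)) : RBC R C G H :=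
  1 ⊗ₜ[ℤ] BurnsideGroup.mk X

/-- The `R`-bilinear composition `RB_C(G × H) × RB_C(H × K) → RB_C(G × K)` extending
`(X, Y) ↦ X ×_H^d Y`. -/
def comp (G H K : Type u) [Group G] [Group H] [Group K] :
    RBC R C G H →ₗ[R] RBC R C H K →ₗ[R] RBC R C G K :=
  LinearMap.liftBaseChange R
    ((LinearMap.baseChangeHom ℤ R _ _).comp (BurnsideGroup.comp G H K C))

theorem comp_mk {C G H K : Type u} [Group C] [Group G] [Group H] [Group K]
    (X : FinGSet (G × H × C)) (Y : FinGSet (H × K × C)) :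
    comp R C G H K (mk R X) (mk R Y) = mk R (FinGSet.comp X Y) := by
  simp [comp, mk, BurnsideGroup.comp_mk]

/-- The submodule `I_{RB_C}(G)` of `RB_C(G × G)` generated by the elements `a ∘ b` with
`a ∈ RB_C(G × K)`, `b ∈ RB_C(K × G)` and `K` a finite group of order smaller than `|G|`. -/
def smallIdeal (G : Type u) [Group G] : Submodule R (RBC R C G G) :=
  Submodule.span R {x | ∃ (K : Type u) (_ : Group K), Finite K ∧ Nat.card K < Nat.card G ∧
    ∃ (a : RBC R C G K) (b : RBC R C K G), x = comp R C G K G a b}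

/-- The quotient of `RB_C(G × G)` by `I_{RB_C}(G)`. -/
abbrev Hat (G : Type u) [Group G] := RBC R C G G ⧸ smallIdeal R C G

end RBC

/-- The subgroup `{(θ(g)ζ(c), g, c)}` of `G × G × C`. -/
def twistedGraph {G C : Type u} [Group G] [Group C] (θ : G ≃* G) (ζ : C →* Subgroup.center G) :
    Subgroup (G × G × C) where
  carrier := {x | ∃ (g : G) (c : C), x = (θ g * (ζ c : G), g, c)}
  one_mem' := ⟨1, 1, by simp; rfl⟩
  mul_mem' := by
    rintro _ _ ⟨g, c, rfl⟩ ⟨g', c', rfl⟩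
    refine ⟨g * g', c * c', ?_⟩
    have h : θ g' * (ζ c : G) = (ζ c : G) * θ g' := Subgroup.mem_center_iff.mp (ζ c).2 (θ g')
    simp only [Prod.mk_mul_mk, map_mul, Subgroup.coe_mul]
    rw [mul_assoc, ← mul_assoc (ζ c : G), ← h]
    simp only [mul_assoc]
  inv_mem' := by
    rintro _ ⟨g, c, rfl⟩
    refine ⟨g⁻¹, c⁻¹, ?_⟩
    have h : (θ g)⁻¹ * (ζ c⁻¹ : G) = (ζ c⁻¹ : G) * (θ g)⁻¹ :=
      Subgroup.mem_center_iff.mp (ζ c⁻¹).2 _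
    rw [map_inv, h]
    simp

end

/-! Fix D = D_{θ,ζ}. Counting the orbits isomorphic to (G × G × C)/D is additive under disjoint
union, so it extends to an R-linear functional on RB_C(G × G). The functional takes the value 1 on
the class of the transitive set with stabilizer D, and it kills I_{RB_C}(G), which gives every
claim. The vanishing is a counting argument: stabilizers in a composite over K are relational
compositions of stabilizers (`mk_mem_stabilizer_comp`). If D were one, each g in G would pass
through some k(g) in K, and injectivity of g ↦ k(g) would contradict |K| < |G|
(`stabilizer_comp_ne_twistedGraph`). -/

namespace FinGSet

/-! ### Counting orbits of a given type -/

variable {L : Type u} [Group L]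

/-- The relation of lying in the same orbit, on the points of `X` with stabilizer `D`. -/
def typeSetoid (D : Subgroup L) (X : FinGSet L) :
    Setoid {x : X.carrier // MulAction.stabilizer L x = D} :=
  (MulAction.orbitRel L X.carrier).comap Subtype.val

theorem typeSetoid_r {D : Subgroup L} {X : FinGSet L}
    {x y : {x : X.carrier // MulAction.stabilizer L x = D}} :
    (typeSetoid D X).r x y ↔ ∃ g : L, g • y.1 = x.1 := Iff.rfl

/-- The number of orbits of `X` isomorphic to `L / D`. -/
noncomputable def orbitCount (D : Subgroup L) (X : FinGSet L) : ℕ := Nat.card (Quotient (typeSetoid D X))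

theorem orbitCount_congr (D : Subgroup L) {X Y : FinGSet L} (h : X ≈ Y) :
    orbitCount D X = orbitCount D Y := by
  obtain ⟨e, he⟩ := h
  have hs : ∀ x, MulAction.stabilizer L (e x) = MulAction.stabilizer L x := fun x => by
    ext g
    rw [MulAction.mem_stabilizer_iff, MulAction.mem_stabilizer_iff, ← he, e.apply_eq_iff_eq]
  refine Nat.card_congr (Quotient.congr (e.subtypeEquiv fun x => by rw [hs]) ?_)
  intro x y
  rw [typeSetoid_r, typeSetoid_r]
  refine exists_congr fun g => ?_
  change _ ↔ g • e y.1 = e x.1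
  rw [← he, e.apply_eq_iff_eq]

theorem stabilizer_inl {X Y : FinGSet L} (x : X.carrier) :
    MulAction.stabilizer L (show (disjUnion X Y).carrier from Sum.inl x) =
      MulAction.stabilizer L x := by
  ext g
  exact Sum.inl_injective.eq_iff (a := g • x)

theorem stabilizer_inr {X Y : FinGSet L} (y : Y.carrier) :
    MulAction.stabilizer L (show (disjUnion X Y).carrier from Sum.inr y) =
      MulAction.stabilizer L y := by
  ext g
  exact Sum.inr_injective.eq_iff (a := g • y)

/-- Both inclusions preserve stabilizers, and no orbit meets both summands. -/
theorem orbitCount_disjUnion (D : Subgroup L) (X Y : FinGSet L) :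
    orbitCount D (disjUnion X Y) = orbitCount D X + orbitCount D Y := by
  rw [orbitCount, orbitCount, orbitCount, ← Nat.card_sum]
  symm
  let i (x : {x : X.carrier // MulAction.stabilizer L x = D}) :
      {z : (disjUnion X Y).carrier // MulAction.stabilizer L z = D} :=
    ⟨Sum.inl x.1, (stabilizer_inl x.1).trans x.2⟩
  let j (y : {y : Y.carrier // MulAction.stabilizer L y = D}) :
      {z : (disjUnion X Y).carrier // MulAction.stabilizer L z = D} :=
    ⟨Sum.inr y.1, (stabilizer_inr y.1).trans y.2⟩
  refine Nat.card_congr (Equiv.ofBijective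
    (β := Quotient (typeSetoid D (disjUnion X Y)))
    (Sum.elim (Quotient.map i ?_) (Quotient.map j ?_)) ⟨?_, ?_⟩)
  · rintro x y ⟨g, hg⟩
    exact ⟨g, congrArg Sum.inl hg⟩
  · rintro x y ⟨g, hg⟩
    exact ⟨g, congrArg Sum.inr hg⟩
  · rintro (⟨⟨x⟩⟩ | ⟨⟨x⟩⟩) (⟨⟨y⟩⟩ | ⟨⟨y⟩⟩) h
    · obtain ⟨g, hg⟩ := Quotient.exact (a := i x) (b := i y) h
      exact congrArg Sum.inl (Quotient.sound ⟨g, Sum.inl_injective hg⟩)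
    · obtain ⟨g, hg⟩ := Quotient.exact (a := i x) (b := j y) h
      exact (Sum.inr_ne_inl hg).elim
    · obtain ⟨g, hg⟩ := Quotient.exact (a := j x) (b := i y) h
      exact (Sum.inl_ne_inr hg).elim
    · obtain ⟨g, hg⟩ := Quotient.exact (a := j x) (b := j y) h
      exact congrArg Sum.inr (Quotient.sound ⟨g, Sum.inr_injective hg⟩)
  · rintro ⟨⟨x | y, h⟩⟩
    · exact ⟨Sum.inl (Quotient.mk _ ⟨x, (stabilizer_inl x).symm.trans h⟩), rfl⟩
    · exact ⟨Sum.inr (Quotient.mk _ ⟨y, (stabilizer_inr y).symm.trans h⟩), rfl⟩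

theorem orbitCount_eq_zero {D : Subgroup L} {X : FinGSet L}
    (h : ∀ x : X.carrier, MulAction.stabilizer L x ≠ D) : orbitCount D X = 0 := by
  have : IsEmpty (Quotient (typeSetoid D X)) := ⟨by rintro ⟨x⟩; exact h x.1 x.2⟩
  exact Nat.card_of_isEmpty

theorem orbitCount_coset [Finite L] (D : Subgroup L) : orbitCount D (coset D) = 1 := by
  refine Nat.card_eq_one_iff_unique.2 ⟨⟨?_⟩,
    ⟨Quotient.mk _ ⟨((1 : L) : L ⧸ D), MulAction.stabilizer_quotient D⟩⟩⟩
  rintro ⟨x⟩ ⟨y⟩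
  exact Quotient.sound (MulAction.exists_smul_eq L (α := L ⧸ D) y.1 x.1)

/-! ### Stabilizers in a composite -/

/-- If `g • [x, y] = [x, y]`, this is witnessed by an element of the middle group. -/
theorem mk_mem_stabilizer_comp {G H K C : Type u} [Group G] [Group H] [Group K] [Group C]
    {X : FinGSet (G × H × C)} {Y : FinGSet (H × K × C)} (x : X.carrier) (y : Y.carrier)
    (a : G × K × C) :
    a ∈ MulAction.stabilizer (G × K × C)
        (show (comp X Y).carrier from Quotient.mk (compSetoid X Y) (x, y)) ↔
      ∃ h : H, (a.1, h, a.2.2) ∈ MulAction.stabilizer (G × H × C) x ∧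
        (h, a.2.1, a.2.2) ∈ MulAction.stabilizer (H × K × C) y := by
  rw [MulAction.mem_stabilizer_iff, comp_smul_mk]
  -- The orbit relation moves points by `h⁻¹`, so the witness for the stabilizers is the inverse of
  -- the one for the relation.
  have key : ∀ h : H, (x, y) = (((1, h⁻¹, 1) : G × H × C) • ((a.1, 1, a.2.2) : G × H × C) • x,
      ((h⁻¹, 1, 1) : H × K × C) • ((1, a.2.1, a.2.2) : H × K × C) • y) ↔
      (a.1, h⁻¹, a.2.2) ∈ MulAction.stabilizer (G × H × C) x ∧
        (h⁻¹, a.2.1, a.2.2) ∈ MulAction.stabilizer (H × K × C) y := fun h => by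
    simp only [smul_smul, Prod.mk_mul_mk, mul_one, one_mul, Prod.mk.injEq,
      MulAction.mem_stabilizer_iff]
    exact and_congr eq_comm eq_comm
  constructor
  · intro h
    obtain ⟨h, hh⟩ := Quotient.exact h
    exact ⟨h⁻¹, (key h).1 hh⟩
  · rintro ⟨h, hh⟩
    refine Quotient.sound ⟨h⁻¹, (key h⁻¹).2 ?_⟩
    rwa [inv_inv]

/-- Over c = 1 the subgroup is the graph of a bijection of G, and such a relation cannot factor
through a set smaller than G. -/
theorem stabilizer_comp_ne_twistedGraph {G K C : Type u} [Group G] [Group K] [Group C] [Finite K]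
    (hK : Nat.card K < Nat.card G) (θ : G ≃* G) (ζ : C →* Subgroup.center G)
    (X : FinGSet (G × K × C)) (Y : FinGSet (K × G × C)) (p : (comp X Y).carrier) :
    MulAction.stabilizer (G × G × C) p ≠ twistedGraph θ ζ := by
  obtain ⟨x, y⟩ := p
  intro hD
  have hmem : ∀ a, a ∈ twistedGraph θ ζ ↔
      ∃ k : K, (a.1, k, a.2.2) ∈ MulAction.stabilizer (G × K × C) x ∧
        (k, a.2.1, a.2.2) ∈ MulAction.stabilizer (K × G × C) y := fun a => by
    rw [← hD]
    exact mk_mem_stabilizer_comp x y a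
  have hg : ∀ g : G, (θ g, g, (1 : C)) ∈ twistedGraph θ ζ := fun g => ⟨g, 1, by simp⟩
  choose k hx hy using fun g => (hmem _).1 (hg g)
  have : ¬ Function.Injective k := fun hk => hK.not_ge (Nat.card_le_card_of_injective k hk)
  refine this fun g g' hgg' => ?_
  -- As k(g) = k(g'), this element links θ(g) on the left to g' on the right; membership in D then
  -- forces θ(g) = θ(g')ζ(1).
  obtain ⟨g₁, c, h⟩ := (hmem (θ g, g', (1 : C))).2 ⟨k g, hx g, hgg' ▸ hy g'⟩
  simp only [Prod.mk.injEq] at h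
  obtain ⟨h, rfl, rfl⟩ := h
  simpa using h

end FinGSet

/-! ### The coefficient functional on RB_C -/

/-- The number of orbits isomorphic to `L / D`, as an additive function of isomorphism classes. -/
noncomputable def GSetClass.orbitCount {L : Type u} [Group L] (R : Type*) [CommRing R] (D : Subgroup L) :
    GSetClass L →+ R where
  toFun := Quotient.lift (fun X => (FinGSet.orbitCount D X : R))
    fun _ _ h => congrArg Nat.cast (FinGSet.orbitCount_congr D h)
  map_zero' := by
    refine (congrArg Nat.cast (FinGSet.orbitCount_eq_zero ?_)).trans Nat.cast_zero
    exact fun x => PEmpty.elim x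
  map_add' := by
    rintro ⟨X⟩ ⟨Y⟩
    exact (congrArg Nat.cast (FinGSet.orbitCount_disjUnion D X Y)).trans (Nat.cast_add _ _)

namespace RBC

variable (R : Type*) [CommRing R] {C G H K : Type u} [Group C] [Group G] [Group H] [Group K]

/-- The coefficient of the class of `(G × H × C) / D`. -/
noncomputable def coeff (D : Subgroup (G × H × C)) : RBC R C G H →ₗ[R] R :=
  LinearMap.liftBaseChange R (BurnsideGroup.liftHom _ _ (GSetClass.orbitCount R D))

theorem coeff_mk (D : Subgroup (G × H × C)) (X : FinGSet (G × H × C)) :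
    coeff R D (mk R X) = FinGSet.orbitCount D X := by
  rw [coeff, mk, LinearMap.liftBaseChange_tmul, one_smul]
  exact BurnsideGroup.liftHom_of _ _

variable {R} in
-- Classes of finite sets generate the Grothendieck group, hence also its base change as an
-- R-module.
theorem hom_ext {M : Type*} [AddCommGroup M] [Module R M] {f g : RBC R C G H →ₗ[R] M}
    (h : ∀ X, f (mk R X) = g (mk R X)) : f = g := by
  refine TensorProduct.AlgebraTensorModule.curry_injective (LinearMap.ext_ring ?_)
  refine LinearMap.toAddMonoidHom_injective (BurnsideGroup.lift_ext ?_)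
  rintro ⟨X⟩
  exact h X

theorem coeff_comp_eq_zero [Finite K] (hK : Nat.card K < Nat.card G) (θ : G ≃* G)
    (ζ : C →* Subgroup.center G) (a : RBC R C G K) (b : RBC R C K G) :
    coeff R (twistedGraph θ ζ) (comp R C G K G a b) = 0 := by
  have : (comp R C G K G).compr₂ (coeff R (twistedGraph θ ζ)) = 0 := by
    refine hom_ext fun X => hom_ext fun Y => ?_
    rw [LinearMap.compr₂_apply, comp_mk, coeff_mk, FinGSet.orbitCount_eq_zero
      (FinGSet.stabilizer_comp_ne_twistedGraph hK θ ζ X Y), Nat.cast_zero]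
    rfl
  exact LinearMap.congr_fun₂ this a b

theorem coeff_eq_zero_of_mem_smallIdeal (θ : G ≃* G) (ζ : C →* Subgroup.center G)
    {x : RBC R C G G} (hx : x ∈ smallIdeal R C G) : coeff R (twistedGraph θ ζ) x = 0 := by
  have : smallIdeal R C G ≤ LinearMap.ker (coeff R (twistedGraph θ ζ)) := by
    refine Submodule.span_le.2 ?_
    rintro _ ⟨K, _, _, hK, a, b, rfl⟩
    exact coeff_comp_eq_zero R hK θ ζ a b
  exact this hx

/-- The coefficient is exactly 1, so it survives in every nonzero R, whatever the characteristic. -/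
theorem mk_coset_notMem_smallIdeal [Nontrivial R] [Finite G] [Finite C] (θ : G ≃* G)
    (ζ : C →* Subgroup.center G) :
    mk R (FinGSet.coset (twistedGraph θ ζ)) ∉ smallIdeal R C G := fun h => by
  have := coeff_eq_zero_of_mem_smallIdeal R θ ζ h
  rw [coeff_mk, FinGSet.orbitCount_coset, Nat.cast_one] at this
  exact one_ne_zero this

end RBC

theorem lemma4p9 (R : Type*) [CommRing R] [Nontrivial R]
    (G C : Type u) [Group G] [Finite G] [Group C] [Finite C] :
    Nontrivial (RBC.Hat R C G) ∧
    ∀ (θ : G ≃* G) (ζ : C →* Subgroup.center G),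
      (Submodule.Quotient.mk (RBC.mk R (FinGSet.coset (twistedGraph θ ζ))) : RBC.Hat R C G) ≠ 0 ∧
      ∀ (K : Type u) [Group K] [Finite K], Nat.card K < Nat.card G →
        ∀ (a : RBC R C G K) (b : RBC R C K G),
          RBC.comp R C G K G a b ≠ RBC.mk R (FinGSet.coset (twistedGraph θ ζ)) := by
  have hne : ∀ (θ : G ≃* G) (ζ : C →* Subgroup.center G),
      (Submodule.Quotient.mk (RBC.mk R (FinGSet.coset (twistedGraph θ ζ))) :
        RBC.Hat R C G) ≠ 0 := fun θ ζ h =>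
    RBC.mk_coset_notMem_smallIdeal R θ ζ ((Submodule.Quotient.mk_eq_zero _).1 h)
  -- The identity automorphism and the trivial ζ always exist, so the quotient has a nonzero
  -- element.
  refine ⟨⟨_, _, hne (MulEquiv.refl G) 1⟩, fun θ ζ => ⟨hne θ ζ, ?_⟩⟩
  intro K _ _ hK a b h
  refine RBC.mk_coset_notMem_smallIdeal R θ ζ (Submodule.subset_span ?_)
  exact ⟨K, inferInstance, inferInstance, hK, a, b, h.symm⟩
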